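/- For a finite group $G$, the enhanced power graph $\mathcal{G}_E(G)$ is the simple graph with vertex set $G$ in which two distinct elements $x,y$ are adjacent if and only if there is $w\in G$ with $x,y\in\langle w\rangle$. For a finite graph $\Gamma$ let $L(\Gamma)$ be its Laplacian matrix (diagonal matrix of degrees minus adjacency matrix), let $\lambda_1(\Gamma)$ be the largest eigenvalue of $L(\Gamma)$, and let $\eta(\lambda_1(\Gamma))$ be its multiplicity as a root of the characteristic polynomial of $L(\Gamma)$. A generalized quaternion group is a group $Q_{2^k}$ with $k\ge 3$. The Sylow subgroups of a finite group are those for the primes dividing its order. Theorem. Let $G$ be a finite nilpotent group no Sylow subgroup of which is generalized quaternion. Then either no Sylow subgroup of $G$ is cyclic or generalized quaternion, or $G\cong G_1\times\mathbb{Z}_n$ where $n\ge 2$, $G_1$ is a finite nilpotent group (possibly trivial) no Sylow subgroup of which is cyclic or generalized quaternion, and $\gcd(|G_1|,n)=1$. Moreover: (1) if no Sylow subgroup of $G$ is cyclic or generalized quaternion, then $\eta(\lambda_1(\mathcal{G}_E(G)))=1$; (2) if $G$ is not cyclic and $G\cong G_1\times\mathbb{Z}_n$, where $n\ge 1$, $G_1$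 is a finite nilpotent group no Sylow subgroup of which is cyclic or generalized quaternion, and $\gcd(|G_1|,n)=1$, then $\eta(\lambda_1(\mathcal{G}_E(G)))=n$. -/

import Mathlib

universe u v

/-- The enhanced power graph of a group: the vertices are the elements of the group, and two
distinct elements are adjacent iff both lie in one common cyclic subgroup. -/
def enhancedPowerGraph (G : Type*) [Group G] : SimpleGraph G where
  Adj u v := u ≠ v ∧ ∃ w : G, u ∈ Subgroup.zpowers w ∧ v ∈ Subgroup.zpowers w
  symm := ⟨fun _ _ h => ⟨h.1.symm, h.2.imp fun _ hw => ⟨hw.2, hw.1⟩⟩⟩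
  loopless := ⟨fun _ h => h.1 rfl⟩

/-- A generalized quaternion group: a group isomorphic to `Q_{2^k}` for some `k ≥ 3`
(Mathlib's `QuaternionGroup m` has order `4 * m`, so `QuaternionGroup (2 ^ (k - 2))` is
`Q_{2^k}`). -/
def IsGeneralizedQuaternion (H : Type*) [Group H] : Prop :=
  ∃ k : ℕ, 3 ≤ k ∧ Nonempty (H ≃* QuaternionGroup (2 ^ (k - 2)))

/-- No Sylow subgroup of `G` is generalized quaternion. -/
def NoQuaternionSylow (G : Type*) [Group G] : Prop :=
  ∀ p : ℕ, p.Prime → p ∣ Nat.card G → ∀ P : Sylow p G, ¬ IsGeneralizedQuaternion P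

/-- No Sylow subgroup of `G` is cyclic or generalized quaternion. Only the primes that divide the
order of `G` count: for the other primes Mathlib's Sylow subgroup is trivial, hence cyclic. -/
def NoCyclicOrQuaternionSylow (G : Type*) [Group G] : Prop :=
  ∀ p : ℕ, p.Prime → p ∣ Nat.card G →
    ∀ P : Sylow p G, ¬ IsCyclic P ∧ ¬ IsGeneralizedQuaternion P

open Classical in
/-- The Laplacian matrix (degrees minus adjacency) of a finite graph, over the reals. -/
noncomputable def laplacian {V : Type*} [Fintype V] (Γ : SimpleGraph V) : Matrix V V ℝ :=
  Γ.lapMatrix ℝ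

open Classical in
/-- The Laplacian characteristic polynomial `det (x I - L)` of a finite graph. -/
noncomputable def laplacianCharpoly {V : Type*} [Fintype V] (Γ : SimpleGraph V) :
    Polynomial ℝ :=
  (laplacian Γ).charpoly

/-- The set of (real) Laplacian eigenvalues of a finite graph. -/
def laplacianEigenvalues {V : Type*} [Fintype V] (Γ : SimpleGraph V) : Set ℝ :=
  {x | (laplacianCharpoly Γ).IsRoot x}

/-- The Laplacian spectral radius: the largest Laplacian eigenvalue. -/
noncomputable def laplacianSpectralRadius {V : Type*} [Fintype V] (Γ : SimpleGraph V) : ℝ :=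
  sSup (laplacianEigenvalues Γ)

/-- On a nonempty finite graph the supremum is attained, so `laplacianSpectralRadius` really is
the largest Laplacian eigenvalue. -/
theorem isGreatest_laplacianSpectralRadius {V : Type*} [Fintype V] [Nonempty V]
    (Γ : SimpleGraph V) :
    IsGreatest (laplacianEigenvalues Γ) (laplacianSpectralRadius Γ) := by
  classical
  have hL : (laplacian Γ).IsHermitian := by
    unfold laplacian
    exact SimpleGraph.isHermitian_lapMatrix _ Γ
  have hchar : laplacianCharpoly Γ = (laplacian Γ).charpoly := by
    unfold laplacianCharpoly
    congr
  have hne : laplacianCharpoly Γ ≠ 0 := by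
    rw [hchar]
    exact (Matrix.charpoly_monic _).ne_zero
  have hfin : (laplacianEigenvalues Γ).Finite := Polynomial.finite_setOfPred_isRoot hne
  have hnon : (laplacianEigenvalues Γ).Nonempty := by
    obtain ⟨v⟩ := ‹Nonempty V›
    refine ⟨hL.eigenvalues v, ?_⟩
    have := hL.eigenvalues_mem_spectrum_real v
    rw [Matrix.mem_spectrum_iff_isRoot_charpoly] at this
    change (laplacianCharpoly Γ).IsRoot _
    rw [hchar]
    exact this
  exact ⟨hnon.csSup_mem hfin, fun x hx => le_csSup hfin.bddAbove hx⟩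

/-- The multiplicity of the largest Laplacian eigenvalue, as a root of the Laplacian
characteristic polynomial. -/
noncomputable def laplacianSpectralRadiusMultiplicity {V : Type*} [Fintype V]
    (Γ : SimpleGraph V) : ℕ :=
  (laplacianCharpoly Γ).rootMultiplicity (laplacianSpectralRadius Γ)

/-! ### The eigenvalue `|V|` of the Laplacian -/

section Laplacian

variable {V : Type*} [Fintype V]

/-! Since `L(Γ) + L(Γᶜ) = |V| I - J`, no Laplacian eigenvalue exceeds `|V|`, and the eigenspace of
`|V|` consists of the sum-zero vectors constant on the components of `Γᶜ`. If a nonempty proper set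
`D` of vertices is dominating and `Γᶜ` is connected off `D`, the components are the points of `D`
and one more, so the multiplicity is `|D|`.

For noncyclic `G ≅ G₁ × ℤₙ` take `D = 1 × ℤₙ`: it is dominating by the Chinese remainder theorem.
Off `D`, connectedness of the complement reduces to `G₁` (`exists_not_joint_cyclic`). There, for
each prime `p` dividing the order and each `x`, some element of order `p` avoids `⟨x⟩`; otherwise a
Sylow `p`-subgroup would have a unique subgroup of order `p`, hence be cyclic or generalized
quaternion (`isCyclic_or_isGeneralizedQuaternion`, proved here from scratch). Part (1) is the case
`n = 1`, apart from the trivial group. The decomposition splits off cyclic Sylow subgroups one at a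
time. -/

theorem laplacianCharpoly_ne_zero (Γ : SimpleGraph V) : laplacianCharpoly Γ ≠ 0 := by
  classical
  unfold laplacianCharpoly
  exact (Matrix.charpoly_monic _).ne_zero

open Classical in
theorem laplacian_mulVec_apply (Γ : SimpleGraph V) (x : V → ℝ) (v : V) :
    (laplacian Γ).mulVec x v = ∑ u, if Γ.Adj v u then x v - x u else 0 := by
  rw [laplacian, SimpleGraph.lapMatrix_mulVec_apply, SimpleGraph.degree_eq_sum_if_adj,
    Finset.sum_mul, ← Finset.sum_filter, SimpleGraph.neighborFinset_eq_filter,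
    Finset.sum_sub_distrib]
  simp [← Finset.sum_filter]

theorem laplacian_compl_mulVec_apply (Γ : SimpleGraph V) (x : V → ℝ) (v : V) :
    (laplacian Γᶜ).mulVec x v =
      Fintype.card V * x v - ∑ u, x u - (laplacian Γ).mulVec x v := by
  classical
  have h : Fintype.card V * x v - ∑ u, x u = ∑ u, (x v - x u) := by
    simp [Finset.sum_sub_distrib]
  rw [h, laplacian_mulVec_apply, laplacian_mulVec_apply, ← Finset.sum_sub_distrib]
  refine Finset.sum_congr rfl fun u _ => ?_
  by_cases huv : v = u
  · simp [huv]
  · by_cases ha : Γ.Adj v u <;> simp [SimpleGraph.compl_adj, huv, ha]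

theorem sum_laplacian_mulVec (Γ : SimpleGraph V) (x : V → ℝ) :
    ∑ v, (laplacian Γ).mulVec x v = 0 := by
  classical
  simp_rw [laplacian_mulVec_apply]
  have h : (∑ v, ∑ u, if Γ.Adj v u then x v - x u else 0) =
      -∑ v, ∑ u, if Γ.Adj v u then x v - x u else 0 := by
    conv_lhs => rw [Finset.sum_comm]
    rw [← Finset.sum_neg_distrib]
    refine Finset.sum_congr rfl fun v _ => ?_
    rw [← Finset.sum_neg_distrib]
    refine Finset.sum_congr rfl fun u _ => ?_
    by_cases ha : Γ.Adj v u
    · simp [ha, ha.symm]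
    · have ha' : ¬ Γ.Adj u v := fun h => ha h.symm
      simp [ha, ha']
  linarith

theorem dotProduct_laplacian_mulVec_nonneg (Γ : SimpleGraph V) (x : V → ℝ) :
    0 ≤ dotProduct x ((laplacian Γ).mulVec x) := by
  classical
  simpa [laplacian] using (SimpleGraph.posSemidef_lapMatrix ℝ Γ).dotProduct_mulVec_nonneg x

/-- Column sums of `L(Γ)` vanish, so an eigenvector for `|V| ≠ 0` has sum zero; on such vectors
`L(Γᶜ) = |V| I - L(Γ)`, and the kernel of a Laplacian is read off from the components. -/
theorem laplacian_mulVec_eq_card_smul_iff [Nonempty V] (Γ : SimpleGraph V) (x : V → ℝ) :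
    (laplacian Γ).mulVec x = (Fintype.card V : ℝ) • x ↔
      ∑ v, x v = 0 ∧ ∀ u v, Γᶜ.Reachable u v → x u = x v := by
  classical
  have key : (laplacian Γᶜ).mulVec x = 0 ↔ ∀ u v, Γᶜ.Reachable u v → x u = x v := by
    rw [← SimpleGraph.lapMatrix_mulVec_eq_zero_iff_forall_reachable, laplacian]
    convert Iff.rfl
  have hcard : (Fintype.card V : ℝ) ≠ 0 := by simp
  rw [← key]
  constructor
  · intro h
    have hs : ∑ v, x v = 0 := by
      have := sum_laplacian_mulVec Γ x
      simp only [h, Pi.smul_apply, smul_eq_mul, ← Finset.mul_sum] at this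
      exact (mul_eq_zero.mp this).resolve_left hcard
    refine ⟨hs, funext fun v => ?_⟩
    rw [laplacian_compl_mulVec_apply, h, hs]
    simp
  · rintro ⟨hs, h⟩
    funext v
    have := laplacian_compl_mulVec_apply Γ x v
    rw [h, hs] at this
    simp only [Pi.zero_apply] at this
    simp only [Pi.smul_apply, smul_eq_mul]
    linarith

theorem le_card_of_mem_laplacianEigenvalues (Γ : SimpleGraph V) {μ : ℝ}
    (hμ : μ ∈ laplacianEigenvalues Γ) : μ ≤ Fintype.card V := by
  classical
  have h : (laplacian Γ).toLin'.charpoly.IsRoot μ := by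
    rw [Matrix.charpoly_toLin']
    have h : (laplacianCharpoly Γ).IsRoot μ := hμ
    unfold laplacianCharpoly at h
    convert h
  obtain ⟨x, hx⟩ := ((Module.End.hasEigenvalue_iff_isRoot_charpoly _ _).mpr h).exists_hasEigenvector
  have hx0 : x ≠ 0 := hx.2
  have hx1 : (laplacian Γ).mulVec x = μ • x := by
    simpa using hx.apply_eq_smul
  have h1 := dotProduct_laplacian_mulVec_nonneg Γᶜ x
  -- If `μ > |V|`, this expression would be negative, against semidefiniteness of `L(Γᶜ)`.
  have h2 : dotProduct x ((laplacian Γᶜ).mulVec x) =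
      (Fintype.card V - μ) * dotProduct x x - (∑ v, x v) * ∑ v, x v := by
    simp only [dotProduct, laplacian_compl_mulVec_apply, hx1, Pi.smul_apply, smul_eq_mul]
    rw [Finset.mul_sum, Finset.sum_mul, ← Finset.sum_sub_distrib]
    exact Finset.sum_congr rfl fun v _ => by ring
  have h3 : 0 < dotProduct x x := by
    refine lt_of_le_of_ne (Finset.sum_nonneg fun i _ => mul_self_nonneg _) fun h => hx0 ?_
    exact dotProduct_self_eq_zero.mp h.symm
  by_contra! hlt
  have h4 := mul_self_nonneg (∑ v, x v)
  have h5 := mul_pos (sub_pos.mpr hlt) h3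
  linarith

/-- A symmetric operator is semisimple, so algebraic and geometric multiplicities agree; the passage
to Euclidean space supplies the inner product. -/
theorem rootMultiplicity_laplacianCharpoly (Γ : SimpleGraph V) (μ : ℝ) :
    (laplacianCharpoly Γ).rootMultiplicity μ =
      Module.finrank ℝ (Module.End.eigenspace (Matrix.mulVecLin (laplacian Γ)) μ) := by
  classical
  have hL : (laplacian Γ).IsHermitian := by
    unfold laplacian
    exact SimpleGraph.isHermitian_lapMatrix _ Γ
  have hs := Matrix.isSymmetric_toEuclideanLin_iff.mpr hL
  have hc : laplacianCharpoly Γ = (Matrix.toEuclideanLin (laplacian Γ)).charpoly := by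
    rw [Matrix.toEuclideanLin, Matrix.toLpLin_eq_toLin, Matrix.charpoly_toLin]
    unfold laplacianCharpoly
    congr
  rw [hc, ← LinearMap.finrank_maxGenEigenspace_eq,
    hs.isFinitelySemisimple.maxGenEigenspace_eq_eigenspace]
  refine LinearEquiv.finrank_eq (LinearEquiv.ofSubmodules (WithLp.linearEquiv 2 ℝ (V → ℝ)) _ _ ?_)
  ext x
  simp only [Submodule.mem_map, Module.End.mem_eigenspace_iff]
  constructor
  · rintro ⟨y, hy, rfl⟩
    have := congrArg WithLp.ofLp hy
    simpa using this
  · intro hx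
    refine ⟨WithLp.toLp 2 x, ?_, by simp⟩
    have := congrArg (WithLp.toLp 2) hx
    simpa using this

open Classical in
/-- If `D` is a nonempty proper set of dominating vertices and the complement of the graph is
connected off `D`, then the largest Laplacian eigenvalue has multiplicity `|D|`. -/
theorem laplacianSpectralRadiusMultiplicity_eq_ncard (Γ : SimpleGraph V) (D : Set V)
    (hdom : ∀ d ∈ D, ∀ v, v ≠ d → Γ.Adj d v) (hD : D.Nonempty) (hD' : Dᶜ.Nonempty)
    (hconn : ∀ u ∉ D, ∀ v ∉ D, Γᶜ.Reachable u v) :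
    laplacianSpectralRadiusMultiplicity Γ = D.ncard := by
  obtain ⟨r, hr⟩ := hD'
  have : Nonempty V := ⟨r⟩
  have hmem : ∀ x : V → ℝ, x ∈ Module.End.eigenspace (Matrix.mulVecLin (laplacian Γ))
      (Fintype.card V : ℝ) ↔ ∑ v, x v = 0 ∧ ∀ v ∉ D, x v = x r := by
    intro x
    rw [Module.End.mem_eigenspace_iff, Matrix.mulVecLin_apply, laplacian_mulVec_eq_card_smul_iff]
    refine and_congr_right fun _ => ⟨fun h v hv => h v r (hconn v hv r hr), fun h u v huv => ?_⟩
    -- Dominating vertices are isolated in the complement.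
    have hiso : ∀ a b : V, a ∈ D → Γᶜ.Reachable a b → a = b := by
      intro a b ha hab
      by_contra hne
      obtain ⟨w⟩ := hab
      cases w with
      | nil => exact hne rfl
      | cons hadj _ =>
        rw [SimpleGraph.compl_adj] at hadj
        exact hadj.2 (hdom a ha _ (Ne.symm hadj.1))
    by_cases hu : u ∈ D
    · rw [hiso u v hu huv]
    · by_cases hv : v ∈ D
      · rw [hiso v u hv huv.symm]
      · rw [h u hu, h v hv]
  let f : Module.End.eigenspace (Matrix.mulVecLin (laplacian Γ)) (Fintype.card V : ℝ) →ₗ[ℝ]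
      (D → ℝ) :=
    (LinearMap.funLeft ℝ ℝ (Subtype.val : D → V)).comp (Submodule.subtype _)
  have hsplit : ∀ x : V → ℝ, (∀ v ∉ D, x v = x r) →
      ∑ v, x v = ∑ d : D, x d + (Finset.univ.filter (· ∉ D)).card * x r := by
    intro x hx
    rw [← Finset.sum_filter_add_sum_filter_not Finset.univ (· ∈ D)]
    congr 1
    · exact (Finset.sum_subtype _ (by simp) _)
    · rw [Finset.sum_congr rfl (g := fun _ => x r) fun v hv => hx v (Finset.mem_filter.mp hv).2]
      simp
  have hpos : ((Finset.univ.filter (· ∉ D)).card : ℝ) ≠ 0 := by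
    have : r ∈ Finset.univ.filter (· ∉ D) := by simpa using hr
    exact_mod_cast (Finset.card_pos.mpr ⟨r, this⟩).ne'
  have hinj : Function.Injective f := by
    rw [← LinearMap.ker_eq_bot, LinearMap.ker_eq_bot']
    rintro ⟨x, hx⟩ h0
    rw [hmem] at hx
    have hxD : ∀ d ∈ D, x d = 0 := fun d hd => congrFun h0 ⟨d, hd⟩
    have h1 := hsplit x hx.2
    rw [hx.1, Finset.sum_eq_zero fun (d : D) _ => hxD d d.2, zero_add] at h1
    have h2 : x r = 0 := (mul_eq_zero.mp h1.symm).resolve_left hpos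
    ext v
    by_cases hv : v ∈ D
    · exact hxD v hv
    · exact (hx.2 v hv).trans h2
  have hsurj : Function.Surjective f := by
    intro y
    -- The constant value off `D` is forced by the vanishing of the total sum.
    let x : V → ℝ := fun v => if h : v ∈ D then y ⟨v, h⟩ else
      -(∑ d, y d) / (Finset.univ.filter (· ∉ D)).card
    have hxD : ∀ d : D, x d = y d := fun d => by simp [x]
    have hx : ∀ v ∉ D, x v = x r := fun v hv => by
      have hr' : r ∉ D := hr
      simp [x, hv, hr']
    refine ⟨⟨x, (hmem x).mpr ⟨?_, hx⟩⟩, funext hxD⟩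
    rw [hsplit x hx]
    simp_rw [hxD]
    have hr' : r ∉ D := hr
    have : x r = -(∑ d, y d) / (Finset.univ.filter (· ∉ D)).card := by simp [x, hr']
    rw [this]
    field_simp
    ring
  have hrank := (LinearEquiv.ofBijective f ⟨hinj, hsurj⟩).finrank_eq
  rw [Module.finrank_fintype_fun_eq_card, ← rootMultiplicity_laplacianCharpoly] at hrank
  have hroot : (Fintype.card V : ℝ) ∈ laplacianEigenvalues Γ := by
    have : Nonempty D := hD.to_subtype
    exact (Polynomial.rootMultiplicity_pos (laplacianCharpoly_ne_zero Γ)).mp (by rw [hrank]; exact Fintype.card_pos)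
  have hrad : laplacianSpectralRadius Γ = Fintype.card V :=
    (isGreatest_laplacianSpectralRadius Γ).unique
      ⟨hroot, fun μ hμ => le_card_of_mem_laplacianEigenvalues Γ hμ⟩
  rw [laplacianSpectralRadiusMultiplicity, hrad, hrank, ← Nat.card_eq_fintype_card,
    Nat.card_coe_set_eq]

theorem laplacianSpectralRadiusMultiplicity_of_subsingleton [Nonempty V] [Subsingleton V]
    (Γ : SimpleGraph V) : laplacianSpectralRadiusMultiplicity Γ = 1 := by
  classical
  refine le_antisymm ?_ ((Polynomial.rootMultiplicity_pos (laplacianCharpoly_ne_zero Γ)).mpr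
    (isGreatest_laplacianSpectralRadius Γ).1)
  rw [laplacianSpectralRadiusMultiplicity, rootMultiplicity_laplacianCharpoly]
  refine (Submodule.finrank_le _).trans ?_
  rw [Module.finrank_fintype_fun_eq_card]
  exact Fintype.card_le_one_iff_subsingleton.mpr inferInstance

end Laplacian

/-! ### Congruences forcing the quaternion relations -/

section NumberTheory

/-- If `S = ∑_{i<p} kⁱ` has the form `p u` with `u ≡ 1 mod p`, then the congruence
`j S + s ≡ 0` modulo `pⁿ` is solvable for `s` annihilated by `k - 1`, provided `k ≢ 1`. -/
theorem exists_dvd_mul_add_of_eq_mul {p : ℕ} (hp : p.Prime) {n : ℕ} {k s S c : ℤ}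
    (hS : S = p * (1 + p * c)) (h1 : (p : ℤ) ^ (n + 1) ∣ (k - 1) * S)
    (h2 : ¬ (p : ℤ) ^ (n + 1) ∣ k - 1) (h3 : (p : ℤ) ^ (n + 1) ∣ (k - 1) * s) :
    ∃ j : ℤ, (p : ℤ) ^ (n + 1) ∣ j * S + s := by
  have hp' : Prime (p : ℤ) := Nat.prime_iff_prime_int.mp hp
  have hp0 : (p : ℤ) ≠ 0 := hp'.ne_zero
  have hu : IsCoprime ((p : ℤ) ^ n) (1 + p * c) :=
    IsCoprime.pow_left ⟨-c, 1, by ring⟩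
  have h4 : (p : ℤ) ^ n ∣ k - 1 := by
    refine hu.dvd_of_dvd_mul_right ?_
    rw [hS, pow_succ', mul_left_comm] at h1
    exact (mul_dvd_mul_iff_left hp0).mp h1
  obtain ⟨t, ht⟩ := h4
  have hpn : (p : ℤ) ^ n ≠ 0 := pow_ne_zero _ hp0
  have ht' : ¬ (p : ℤ) ∣ t := fun h => h2 (by
    rw [ht, pow_succ]
    exact mul_dvd_mul_left _ h)
  have hs : (p : ℤ) ∣ s := by
    rw [ht, pow_succ, mul_assoc] at h3
    exact (hp'.dvd_or_dvd ((mul_dvd_mul_iff_left hpn).mp h3)).resolve_left ht'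
  obtain ⟨s', rfl⟩ := hs
  obtain ⟨x, y, hxy⟩ := hu
  -- With `x pⁿ + y (1 + pc) = 1`, this `j` gives `j S + p s' = p s' x pⁿ`.
  refine ⟨-s' * y, s' * x, ?_⟩
  rw [hS, pow_succ]
  linear_combination (p * s') * (-hxy)

/-- The arithmetic behind the classification of the groups of prime power order with a unique
subgroup of prime order. -/
theorem quaternion_congruences {p : ℕ} (hp : p.Prime) {n : ℕ} {k s : ℤ}
    (h1 : (p : ℤ) ^ n ∣ k ^ p - 1) (h2 : ¬ (p : ℤ) ^ n ∣ k - 1)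
    (h3 : (p : ℤ) ^ n ∣ (k - 1) * s)
    (h4 : ∀ j : ℤ, ¬ (p : ℤ) ^ n ∣ j * (∑ i ∈ Finset.range p, k ^ i) + s) :
    p = 2 ∧ 2 ≤ n ∧ (p : ℤ) ^ n ∣ k + 1 ∧ (p : ℤ) ^ n ∣ s - 2 ^ (n - 1) := by
  have : Fact p.Prime := ⟨hp⟩
  have hp' : Prime (p : ℤ) := Nat.prime_iff_prime_int.mp hp
  obtain _ | n := n
  · exact absurd (by simp) h2
  -- Fermat: `k ^ p ≡ k` modulo `p`.
  have hk : (p : ℤ) ∣ k - 1 := by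
    have h := (dvd_pow_self (p : ℤ) n.succ_ne_zero).trans h1
    rw [← ZMod.intCast_zmod_eq_zero_iff_dvd] at h ⊢
    push_cast at h ⊢
    rwa [ZMod.pow_card] at h
  have hgeom : (k - 1) * ∑ i ∈ Finset.range p, k ^ i = k ^ p - 1 := mul_geom_sum k p
  have hn : 1 ≤ n := by
    by_contra! h
    obtain rfl : n = 0 := by lia
    exact h2 (by simpa using hk)
  have hno : ¬ ∃ c : ℤ, ∑ i ∈ Finset.range p, k ^ i = p * (1 + p * c) := by
    rintro ⟨c, hc⟩
    obtain ⟨j, hj⟩ := exists_dvd_mul_add_of_eq_mul hp hc (hgeom ▸ h1) h2 h3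
    exact h4 j hj
  obtain ⟨m, hm⟩ := hk
  -- For odd `p` and `k ≡ 1` mod `p`, the geometric sum is `≡ p` mod `p²`, the form excluded by
  -- `hno`.
  obtain rfl : p = 2 := by
    by_contra hp2
    refine hno ?_
    obtain ⟨c, hc⟩ := odd_sq_dvd_geom_sum₂_sub (a := (1 : ℤ)) (b := m) (hp.odd_of_ne_two hp2)
    refine ⟨c, ?_⟩
    have hk' : k = 1 + p * m := by linarith
    simp only [one_pow, mul_one] at hc
    rw [hk']
    linear_combination hc
  have hS : ∑ i ∈ Finset.range 2, k ^ i = 1 + k := by simp [Finset.sum_range_succ]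
  rw [hS] at hno h4
  push_cast at *
  have hmodd : ¬ (2 : ℤ) ∣ m := by
    rintro ⟨c, rfl⟩
    exact hno ⟨c, by linarith⟩
  have h24 : (2 : ℤ) ^ n ∣ 1 + k := by
    have h5 : (2 : ℤ) ^ (n + 1) ∣ (2 * m) * (1 + k) := by
      rw [← hm]
      convert h1 using 1
      ring
    rw [pow_succ', mul_assoc] at h5
    have h6 := (mul_dvd_mul_iff_left two_ne_zero).mp h5
    exact IsCoprime.dvd_of_dvd_mul_left
      (IsCoprime.pow_left ((Prime.coprime_iff_not_dvd Int.prime_two).mpr hmodd)) h6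
  have hs : (2 : ℤ) ^ n ∣ s := by
    rw [hm, pow_succ', mul_assoc] at h3
    have h6 := (mul_dvd_mul_iff_left two_ne_zero).mp h3
    exact IsCoprime.dvd_of_dvd_mul_left
      (IsCoprime.pow_left ((Prime.coprime_iff_not_dvd Int.prime_two).mpr hmodd)) h6
  obtain ⟨d, hd⟩ := h24
  obtain ⟨s', rfl⟩ := hs
  have hdvd : ∀ e : ℤ, (2 : ℤ) ^ (n + 1) ∣ 2 ^ n * e ↔ 2 ∣ e := fun e => by
    rw [pow_succ]
    exact mul_dvd_mul_iff_left (by positivity)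
  -- Now `1 + k = 2ⁿ d` and `s = 2ⁿ s'`, with modulus `2ⁿ⁺¹`: `j = 0` in `h4` makes `s'` odd, and `j
  -- = 1` makes `d + s'` odd.
  have hs' : ¬ (2 : ℤ) ∣ s' := by
    have := h4 0
    rwa [zero_mul, zero_add, hdvd] at this
  have hd2 : (2 : ℤ) ∣ d := by
    have := h4 1
    rw [hd, one_mul, ← mul_add, hdvd] at this
    omega
  refine ⟨trivial, by lia, ?_, ?_⟩
  · rw [add_comm k, hd, hdvd]
    exact hd2
  · rw [← mul_sub_one, hdvd]
    omega

end NumberTheory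

/-! ### Self-centralizing normal subgroups and cyclic abelian `p`-groups -/

section Groups

/-- Take `A` maximal among abelian normal subgroups. An `x` in the centralizer but outside `A`, as
low as possible in the upper central series, has all its commutators in `A`, so `A⟨x⟩` is a larger
such subgroup. -/
theorem exists_normal_centralizer_eq (P : Type*) [Group P] [Finite P] [Group.IsNilpotent P] :
    ∃ A : Subgroup P, A.Normal ∧ Subgroup.centralizer (A : Set P) = A := by
  obtain ⟨A, ⟨hAn, hAc⟩, hmax⟩ := (Set.toFinite
    {A : Subgroup P | A.Normal ∧ A ≤ Subgroup.centralizer (A : Set P)}).exists_maximal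
    ⟨⊥, inferInstance, bot_le⟩
  refine ⟨A, hAn, le_antisymm ?_ hAc⟩
  by_contra hC
  obtain ⟨x₀, hx₀C, hx₀A⟩ := SetLike.not_le_iff_exists.mp hC
  obtain ⟨N, hN⟩ := Group.IsNilpotent.nilpotent P
  have hex : ∃ i, ∃ x ∈ Subgroup.centralizer (A : Set P),
      x ∈ Subgroup.upperCentralSeries P i ∧ x ∉ A := ⟨N, x₀, hx₀C, by simp [hN], hx₀A⟩
  classical
  obtain ⟨x, hxC, hxZ, hxA⟩ := Nat.find_spec hex
  obtain ⟨i, hi⟩ : ∃ i, Nat.find hex = i + 1 := by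
    refine Nat.exists_eq_succ_of_ne_zero fun h0 => hxA ?_
    rw [h0, Subgroup.upperCentralSeries_zero, Subgroup.mem_bot] at hxZ
    exact hxZ ▸ A.one_mem
  have hmin : ∀ y ∈ Subgroup.centralizer (A : Set P),
      y ∈ Subgroup.upperCentralSeries P i → y ∈ A := by
    intro y hyC hyZ
    by_contra hyA
    exact Nat.find_min hex (m := i) (by lia) ⟨y, hyC, hyZ, hyA⟩
  rw [hi] at hxZ
  have hzC : Subgroup.zpowers x ≤ Subgroup.centralizer (A : Set P) := Subgroup.zpowers_le.mpr hxC
  have hconj : ∀ g, g * x * g⁻¹ ∈ A ⊔ Subgroup.zpowers x := by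
    intro g
    have h1 : x * g * x⁻¹ * g⁻¹ ∈ A := by
      refine hmin _ ?_ (Subgroup.mem_upperCentralSeries_succ_iff.mp hxZ g)
      rw [mul_assoc, mul_assoc]
      refine mul_mem hxC ?_
      rw [← mul_assoc]
      exact (inferInstance : (Subgroup.centralizer (A : Set P)).Normal).conj_mem _
        (inv_mem hxC) g
    have h2 : g * x * g⁻¹ = (x * g * x⁻¹ * g⁻¹)⁻¹ * x := by group
    rw [h2]
    exact mul_mem (Subgroup.mem_sup_left (inv_mem h1))
      (Subgroup.mem_sup_right (Subgroup.mem_zpowers x))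
  have hB : A ⊔ Subgroup.zpowers x ∈
      {A : Subgroup P | A.Normal ∧ A ≤ Subgroup.centralizer (A : Set P)} := by
    refine ⟨⟨fun b hb g => ?_⟩, sup_le ?_ ?_⟩
    · have : A ⊔ Subgroup.zpowers x ≤
          (A ⊔ Subgroup.zpowers x).comap (MulAut.conj g).toMonoidHom := by
        refine sup_le (fun a ha => ?_) (Subgroup.zpowers_le.mpr ?_)
        · exact Subgroup.mem_sup_left (hAn.conj_mem a ha g)
        · exact hconj g
      exact this hb
    · exact Subgroup.le_centralizer_iff.mp (sup_le hAc hzC)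
    · refine Subgroup.le_centralizer_iff.mp (sup_le (Subgroup.le_centralizer_iff.mp hzC) ?_)
      exact Subgroup.le_centralizer _
  exact hxA (hmax hB le_sup_left (Subgroup.mem_sup_right (Subgroup.mem_zpowers x)))

/-- Let `g` have maximal order. Then `⟨g⟩` contains all elements of order `p`; if `y ^ p = g ^ t`,
the exponent bound forces `p ∣ t`, and `y g ^ (-t/p)` is killed by `p`. -/
theorem isCyclic_of_orderOf_prime_mem_zpowers {A : Type*} [CommGroup A] [Finite A] {p : ℕ}
    (hp : p.Prime) (hA : IsPGroup p A)
    (h : ∀ x y : A, orderOf x = p → orderOf y = p → y ∈ Subgroup.zpowers x) : IsCyclic A := by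
  have : Fact p.Prime := ⟨hp⟩
  obtain ⟨g, hg⟩ := Monoid.exists_orderOf_eq_exponent (Monoid.ExponentExists.of_finite (G := A))
  obtain ⟨k, hk⟩ := IsPGroup.iff_orderOf.mp hA g
  have hexp : ∀ y : A, y ^ p ^ k = 1 := fun y => by
    rw [← hk, hg]
    exact Monoid.pow_exponent_eq_one y
  obtain _ | k := k
  · have : Subsingleton A := ⟨fun a b => by
      have ha := hexp a
      have hb := hexp b
      rw [pow_zero, pow_one] at ha hb
      rw [ha, hb]⟩
    infer_instance
  have hord : orderOf (g ^ p ^ k) = p := by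
    rw [orderOf_pow' _ (pow_ne_zero _ hp.ne_zero), hk,
      Nat.gcd_eq_right (pow_dvd_pow p k.le_succ), pow_succ',
      Nat.mul_div_cancel _ (pow_pos hp.pos k)]
  have hprime : ∀ y : A, y ^ p = 1 → y ∈ Subgroup.zpowers g := by
    intro y hy
    by_cases hy1 : y = 1
    · exact hy1 ▸ one_mem _
    · exact Subgroup.zpowers_le.mpr (Subgroup.npow_mem_zpowers g (p ^ k))
        (h _ y hord (orderOf_eq_prime hy hy1))
  have key : ∀ j, ∀ y : A, y ^ p ^ j = 1 → y ∈ Subgroup.zpowers g := by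
    intro j
    induction j with
    | zero =>
      intro y hy
      rw [pow_zero, pow_one] at hy
      exact hy ▸ one_mem _
    | succ j ih =>
      intro y hy
      obtain ⟨t, ht⟩ := ih (y ^ p) (by rw [← pow_mul, ← pow_succ', hy])
      simp only at ht
      have hpt : (p : ℤ) ∣ t := by
        have h1 : g ^ (t * (p ^ k : ℕ)) = 1 := by
          rw [zpow_mul, ht, zpow_natCast, ← pow_mul, ← pow_succ', hexp]
        rw [← orderOf_dvd_iff_zpow_eq_one, hk, pow_succ', mul_comm t] at h1
        push_cast at h1
        rw [mul_comm (p : ℤ)] at h1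
        exact (mul_dvd_mul_iff_left (pow_ne_zero _ (by exact_mod_cast hp.ne_zero))).mp h1
      obtain ⟨t', rfl⟩ := hpt
      have h2 : y * (g ^ t')⁻¹ ∈ Subgroup.zpowers g := by
        apply hprime
        rw [mul_pow, ← ht, inv_pow, ← zpow_natCast (g ^ t'), ← zpow_mul, mul_comm t',
          mul_inv_cancel]
      simpa using mul_mem h2 (Subgroup.zpow_mem_zpowers g t')
  exact ⟨g, fun y => key (k + 1) y (hexp y)⟩

end Groups

/-! ### `p`-groups with a unique subgroup of order `p` -/

section Groups

variable {P : Type*} [Group P]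

theorem mul_zpow_of_conj_eq_zpow {a y : P} {k : ℤ} (h : y * a * y⁻¹ = a ^ k) (e : ℤ) :
    y * a ^ e = a ^ (k * e) * y := by
  rw [zpow_mul, ← h, conj_zpow, inv_mul_cancel_right]

theorem zpow_mul_pow_of_conj_eq_zpow {a y : P} {k : ℤ} (h : y * a * y⁻¹ = a ^ k) (j : ℤ) (m : ℕ) :
    (a ^ j * y) ^ m = a ^ (j * ∑ i ∈ Finset.range m, k ^ i) * y ^ m := by
  induction m with
  | zero => simp
  | succ m ih =>
    rw [pow_succ', ih, mul_assoc, ← mul_assoc y, mul_zpow_of_conj_eq_zpow h, mul_assoc _ y,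
      ← pow_succ', ← mul_assoc, ← zpow_add, geom_sum_succ]
    congr 2
    ring

theorem conj_pow_eq_zpow_pow {a y : P} {k : ℤ} (h : y * a * y⁻¹ = a ^ k) (m : ℕ) :
    y ^ m * a * (y ^ m)⁻¹ = a ^ (k ^ m) := by
  induction m with
  | zero => simp
  | succ m ih =>
    have h1 : y ^ (m + 1) * a * (y ^ (m + 1))⁻¹ = y * (y ^ m * a * (y ^ m)⁻¹) * y⁻¹ := by
      rw [pow_succ']
      group
    rw [h1, ih, mul_zpow_of_conj_eq_zpow h, mul_inv_cancel_right, pow_succ']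

/-- A `p`-th root outside a self-centralizing normal cyclic `p`-subgroup that contains all elements
of order `p` satisfies the relations of a generalized quaternion group. -/
theorem quaternion_relations {p n : ℕ} (hp : p.Prime) {a y : P} (ha : orderOf a = p ^ n)
    (hcent : ∀ z, z * a * z⁻¹ = a → z ∈ Subgroup.zpowers a)
    (hord : ∀ z, z ^ p = 1 → z ∈ Subgroup.zpowers a)
    (hnorm : y * a * y⁻¹ ∈ Subgroup.zpowers a) (hy : y ∉ Subgroup.zpowers a)
    (hyp : y ^ p ∈ Subgroup.zpowers a) :
    p = 2 ∧ 2 ≤ n ∧ y * a * y⁻¹ = a⁻¹ ∧ y ^ 2 = a ^ 2 ^ (n - 1) := by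
  obtain ⟨k, hk⟩ := hnorm
  obtain ⟨s, hs⟩ := hyp
  simp only at hk hs
  have heq : ∀ i j : ℤ, (p : ℤ) ^ n ∣ i - j ↔ a ^ i = a ^ j := by
    intro i j
    rw [zpow_eq_zpow_iff_modEq, ha, Int.modEq_comm, Int.modEq_iff_dvd]
    push_cast
    rfl
  have h1 : (p : ℤ) ^ n ∣ k ^ p - 1 := by
    rw [heq, ← conj_pow_eq_zpow_pow hk.symm, ← hs, zpow_one, ← zpow_add_one, ← zpow_neg,
      ← zpow_add, add_assoc, add_comm, add_assoc]
    simp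
  have h2 : ¬ (p : ℤ) ^ n ∣ k - 1 := by
    rw [heq, hk, zpow_one]
    exact fun h => hy (hcent y h)
  have h3 : (p : ℤ) ^ n ∣ (k - 1) * s := by
    rw [sub_mul, one_mul, heq, ← mul_inv_eq_iff_eq_mul.mpr (mul_zpow_of_conj_eq_zpow hk.symm s), hs,
      ← pow_succ', pow_succ, mul_inv_cancel_right]
  -- Otherwise `(a ^ j * y) ^ p = 1`, which puts `a ^ j * y`, hence `y`, in `⟨a⟩`.
  have h4 : ∀ j : ℤ, ¬ (p : ℤ) ^ n ∣ j * (∑ i ∈ Finset.range p, k ^ i) + s := by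
    intro j hj
    rw [← sub_zero (_ + s), heq, zpow_add, hs, ← zpow_mul_pow_of_conj_eq_zpow hk.symm,
      zpow_zero] at hj
    exact hy ((Subgroup.mul_mem_cancel_left _ (Subgroup.zpow_mem_zpowers a j)).mp (hord _ hj))
  obtain ⟨rfl, hn, h5, h6⟩ := quaternion_congruences hp h1 h2 h3 h4
  refine ⟨rfl, hn, ?_, ?_⟩
  · rw [← hk, ← zpow_neg_one, ← heq, sub_neg_eq_add]
    exact h5
  · rw [← hs, ← zpow_natCast a, ← heq]
    push_cast
    exact h6

/-- The relations make `a i ↦ a ^ i`, `xa i ↦ x a ^ i` a homomorphism; it is injective because `x ∉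
⟨a⟩`, and surjective because `⟨a⟩` and `x⟨a⟩` cover the group. -/
theorem nonempty_mulEquiv_quaternionGroup {m : ℕ} {a x : P} (ha : orderOf a = 2 * m)
    (hx : x ∉ Subgroup.zpowers a) (hxa : x * a * x⁻¹ = a⁻¹) (hx2 : x ^ 2 = a ^ m)
    (hall : ∀ z, z ∈ Subgroup.zpowers a ∨ x⁻¹ * z ∈ Subgroup.zpowers a) :
    Nonempty (P ≃* QuaternionGroup m) := by
  let e : ZMod (2 * m) → P := fun i => a ^ (i.cast : ℤ)
  have he : ∀ z : ℤ, e z = a ^ z := by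
    intro z
    simp only [e]
    rw [zpow_eq_zpow_iff_modEq, ha, ZMod.coe_intCast]
    exact Int.mod_modEq _ _
  have hcomm : ∀ z : ℤ, a ^ z * x = x * a ^ (-z) := by
    intro z
    rw [mul_zpow_of_conj_eq_zpow (k := -1) (by rw [hxa, zpow_neg_one])]
    simp
  let f : QuaternionGroup m → P := fun q => match q with
    | .a i => e i
    | .xa i => x * e i
  have hmul : ∀ q r, f (q * r) = f q * f r := by
    rintro (i | i) (j | j) <;> obtain ⟨i, rfl⟩ := ZMod.intCast_surjective i <;>
      obtain ⟨j, rfl⟩ := ZMod.intCast_surjective j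
    · simp only [QuaternionGroup.a_mul_a, f]
      rw [← Int.cast_add, he, he, he, zpow_add]
    · simp only [QuaternionGroup.a_mul_xa, f]
      rw [← Int.cast_sub, he, he, he, ← mul_assoc, hcomm, mul_assoc, ← zpow_add, neg_add_eq_sub]
    · simp only [QuaternionGroup.xa_mul_a, f]
      rw [← Int.cast_add, he, he, he, zpow_add, mul_assoc]
    · simp only [QuaternionGroup.xa_mul_xa, f]
      rw [← Int.cast_natCast m, ← Int.cast_add, ← Int.cast_sub, he, he, he, mul_assoc,
        ← mul_assoc _ x, hcomm, mul_assoc, ← zpow_add, ← mul_assoc, ← pow_two, hx2,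
        ← zpow_natCast, ← zpow_add]
      congr 1
      ring
  let F : QuaternionGroup m →* P := MonoidHom.mk' f hmul
  have hinj : Function.Injective F := by
    rw [injective_iff_map_eq_one]
    rintro (i | i) hi <;> obtain ⟨i, rfl⟩ := ZMod.intCast_surjective i
    · have h1 : a ^ i = 1 := (he i).symm.trans hi
      rw [← orderOf_dvd_iff_zpow_eq_one, ha] at h1
      rw [(ZMod.intCast_zmod_eq_zero_iff_dvd _ _).mpr h1, QuaternionGroup.a_zero]
    · have h1 : x * a ^ i = 1 := by
        rw [← he]
        exact hi
      rw [mul_eq_one_iff_eq_inv] at h1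
      exact absurd (h1 ▸ inv_mem (Subgroup.zpow_mem_zpowers a i)) hx
  have hsurj : Function.Surjective F := by
    intro z
    rcases hall z with ⟨i, hi⟩ | ⟨i, hi⟩
    · exact ⟨.a i, (he i).trans hi⟩
    · refine ⟨.xa i, ?_⟩
      change x * e i = z
      rw [he, show a ^ i = x⁻¹ * z from hi, mul_inv_cancel_left]
  exact ⟨(MulEquiv.ofBijective F ⟨hinj, hsurj⟩).symm⟩

/-- A finite group of prime power order with a unique subgroup of prime order is cyclic or
generalized quaternion. -/
theorem isCyclic_or_isGeneralizedQuaternion [Finite P] {p : ℕ} (hp : p.Prime) (hP : IsPGroup p P)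
    (h : ∀ x y : P, orderOf x = p → orderOf y = p → y ∈ Subgroup.zpowers x) :
    IsCyclic P ∨ IsGeneralizedQuaternion P := by
  have : Fact p.Prime := ⟨hp⟩
  have : Group.IsNilpotent P := hP.isNilpotent
  obtain ⟨A, hAn, hAc⟩ := exists_normal_centralizer_eq P
  have hAcomm : ∀ b c : A, b * c = c * b := by
    intro b c
    have hb : (b : P) ∈ Subgroup.centralizer (A : Set P) := hAc.symm ▸ b.2
    exact Subtype.ext (Subgroup.mem_centralizer_iff.mp hb c c.2).symm
  let _ : CommGroup A := { (inferInstance : Group A) with mul_comm := hAcomm }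
  obtain ⟨⟨a, haA⟩, hagen⟩ := isCyclic_of_orderOf_prime_mem_zpowers hp (hP.to_subgroup A) (by
    intro x y hx hy
    obtain ⟨k, hk⟩ := h x y (by rwa [Subgroup.orderOf_coe]) (by rwa [Subgroup.orderOf_coe])
    exact ⟨k, Subtype.ext (by simpa using hk)⟩)
  obtain rfl : Subgroup.zpowers a = A := by
    refine le_antisymm (Subgroup.zpowers_le.mpr haA) fun b hb => ?_
    obtain ⟨k, hk⟩ := hagen ⟨b, hb⟩
    exact ⟨k, by simpa using congrArg Subtype.val hk⟩
  by_cases htop : ∀ y, y ∈ Subgroup.zpowers a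
  · exact Or.inl ⟨a, htop⟩
  right
  push Not at htop
  obtain ⟨y₀, hy₀⟩ := htop
  obtain ⟨n, hn⟩ := IsPGroup.iff_orderOf.mp hP a
  have hcent : ∀ z, z * a * z⁻¹ = a → z ∈ Subgroup.zpowers a := by
    intro z hz
    rw [← hAc, Subgroup.mem_centralizer_iff]
    rintro _ ⟨k, rfl⟩
    exact (Commute.zpow_left (mul_inv_eq_iff_eq_mul.mp hz).symm k).eq
  have hnorm : ∀ z, z * a * z⁻¹ ∈ Subgroup.zpowers a := hAn.conj_mem a haA
  have hord : ∀ z, z ^ p = 1 → z ∈ Subgroup.zpowers a := by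
    intro z hz
    obtain _ | n := n
    · rw [pow_zero, orderOf_eq_one_iff] at hn
      exact hcent z (by simp [hn])
    by_cases hz1 : z = 1
    · exact hz1 ▸ one_mem _
    · refine Subgroup.zpowers_le.mpr (Subgroup.npow_mem_zpowers a (p ^ n))
        (h _ z ?_ (orderOf_eq_prime hz hz1))
      rw [orderOf_pow' _ (pow_ne_zero _ hp.ne_zero), hn,
        Nat.gcd_eq_right (pow_dvd_pow p n.le_succ), pow_succ',
        Nat.mul_div_cancel _ (pow_pos hp.pos n)]
  have hpow : ∀ y : P, ∃ j, y ^ p ^ j ∈ Subgroup.zpowers a := by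
    intro y
    obtain ⟨j, hj⟩ := hP y
    exact ⟨j, hj ▸ one_mem _⟩
  have hrel := fun y => quaternion_relations hp hn hcent hord (hnorm y)
  -- The last of the powers `y₀ ^ p ^ j` outside `⟨a⟩` satisfies the hypotheses of
  -- `quaternion_relations`.
  obtain ⟨rfl, hn2⟩ : p = 2 ∧ 2 ≤ n := by
    by_contra hcon
    have hstep : ∀ j, y₀ ^ p ^ j ∉ Subgroup.zpowers a := by
      intro j
      induction j with
      | zero => simpa using hy₀
      | succ j ih =>
        intro hj
        rw [pow_succ, pow_mul] at hj
        obtain ⟨h1, h2, -⟩ := hrel _ ih hj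
        exact hcon ⟨h1, h2⟩
    obtain ⟨j, hj⟩ := hpow y₀
    exact hstep j hj
  -- Otherwise some square outside `⟨a⟩` inverts `a`; its root acts by an exponent `k` with `k² ≡
  -- -1` mod `2ⁿ`, impossible mod 4.
  have hsq : ∀ y, y ^ 2 ∈ Subgroup.zpowers a := by
    intro y
    by_contra hy
    have hstep : ∀ j, y ^ 2 ^ (j + 1) ∉ Subgroup.zpowers a := by
      intro j
      induction j with
      | zero => simpa using hy
      | succ j ih =>
        intro hj
        rw [pow_succ, pow_mul] at hj
        have h1 := (hrel _ ih hj).2.2.1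
        obtain ⟨k, hk⟩ := hnorm (y ^ 2 ^ j)
        have h2 := conj_pow_eq_zpow_pow hk.symm 2
        rw [← pow_mul, ← pow_succ, h1, ← zpow_neg_one, zpow_eq_zpow_iff_modEq, hn,
          Int.modEq_iff_dvd] at h2
        have h3 : (4 : ℤ) ∣ k ^ 2 - -1 := by
          refine Dvd.dvd.trans ?_ h2
          push_cast
          exact pow_dvd_pow 2 hn2
        have h4 : k % 4 = 0 ∨ k % 4 = 1 ∨ k % 4 = 2 ∨ k % 4 = 3 := by omega
        rcases h4 with h4 | h4 | h4 | h4 <;>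
          · have := Int.emod_eq_zero_of_dvd h3
            rw [sub_neg_eq_add, Int.add_emod, pow_two, Int.mul_emod, h4] at this
            norm_num at this
    obtain ⟨j, hj⟩ := hpow y
    refine hstep j ?_
    rw [pow_succ, pow_mul]
    exact pow_mem hj 2
  obtain ⟨-, -, hinv, hy2⟩ := hrel y₀ hy₀ (hsq y₀)
  refine ⟨n + 1, by lia, nonempty_mulEquiv_quaternionGroup (a := a) (x := y₀) ?_ hy₀ hinv ?_ ?_⟩
  · rw [hn, ← pow_succ']
    congr 1
    lia
  · rw [hy2]
    congr 2
  · intro z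
    by_cases hz : z ∈ Subgroup.zpowers a
    · exact Or.inl hz
    -- Both `y₀` and `z` invert `a`, so `y₀⁻¹ z` centralizes it.
    · refine Or.inr (hcent _ ?_)
      have h1 := (hrel z hz (hsq z)).2.2.1
      have h2 : y₀⁻¹ * z * a * (y₀⁻¹ * z)⁻¹ = y₀⁻¹ * (z * a * z⁻¹) * y₀ := by group
      rw [h2, h1, ← hinv]
      group

end Groups

/-! ### Joint cyclic subgroups and the splitting of nilpotent groups -/

section Groups

/-- In a finite nilpotent group, elements of coprime orders commute. -/
theorem commute_of_coprime_orderOf {G : Type*} [Group G] [Finite G] [Group.IsNilpotent G] {x y : G}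
    (h : (orderOf x).Coprime (orderOf y)) : Commute x y := by
  obtain ⟨e⟩ := ((Group.isNilpotent_of_finite_tfae (G := G)).out 0 4 rfl rfl).mp ‹_›
  have key : Commute (e.symm x) (e.symm y) := by
    -- In the product of the Sylow subgroups, each coordinate of `x` or of `y` is trivial.
    refine funext fun p => funext fun P => ?_
    have hp : p.1.Prime := Nat.prime_of_mem_primeFactors p.2
    have aux : ∀ z : G, ¬ p.1 ∣ orderOf z → e.symm z p P = 1 := by
      intro z hz
      have h1 : orderOf (e.symm z p P) ∣ orderOf z := by
        refine orderOf_dvd_of_pow_eq_one ?_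
        rw [← Pi.pow_apply, ← Pi.pow_apply, ← map_pow, pow_orderOf_eq_one, map_one]
        rfl
      have : Fact p.1.Prime := ⟨hp⟩
      obtain ⟨k, hk⟩ := IsPGroup.iff_orderOf.mp P.isPGroup' (e.symm z p P)
      obtain _ | k := k
      · rwa [pow_zero, orderOf_eq_one_iff] at hk
      · exact absurd ((dvd_pow_self _ k.succ_ne_zero).trans (hk ▸ h1)) hz
    by_cases hx : p.1 ∣ orderOf x
    · have hy : ¬ p.1 ∣ orderOf y := fun hy => Nat.not_coprime_of_dvd_of_dvd hp.one_lt hx hy h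
      simp [aux y hy]
    · simp [aux x hx]
  have := key.map e
  simpa using this

/-- A finite cyclic group has one subgroup of each order, containing every element whose order
divides it. -/
theorem mem_zpowers_of_orderOf_dvd {G : Type*} [Group G] {w x y : G} (hw : IsOfFinOrder w)
    (hx : x ∈ Subgroup.zpowers w) (hy : y ∈ Subgroup.zpowers w) (h : orderOf y ∣ orderOf x) :
    y ∈ Subgroup.zpowers x := by
  obtain ⟨i, rfl⟩ := hx
  obtain ⟨j, rfl⟩ := hy
  simp only at h ⊢
  have hN : orderOf w ≠ 0 := hw.orderOf_pos.ne'
  have hd0 : Int.gcd i (orderOf w) ≠ 0 := by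
    rw [Ne, Int.gcd_eq_zero_iff]
    exact fun h => hN (by exact_mod_cast h.2)
  obtain ⟨c, hc⟩ : (Int.gcd i (orderOf w) : ℤ) ∣ orderOf w := Int.gcd_dvd_right ..
  obtain ⟨i', hi'⟩ : (Int.gcd i (orderOf w) : ℤ) ∣ i := Int.gcd_dvd_left ..
  have h1 : (w ^ i) ^ c = 1 := by
    rw [← zpow_mul, ← orderOf_dvd_iff_zpow_eq_one]
    exact ⟨i', by linear_combination c * hi' - i' * hc⟩
  have h2 : (w ^ j) ^ c = 1 := by
    rw [← orderOf_dvd_iff_zpow_eq_one] at h1 ⊢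
    exact (Int.natCast_dvd_natCast.mpr h).trans h1
  rw [← zpow_mul, ← orderOf_dvd_iff_zpow_eq_one] at h2
  have hc0 : c ≠ 0 := by
    rintro rfl
    exact hN (by exact_mod_cast hc.trans (mul_zero _))
  have h3 : (Int.gcd i (orderOf w) : ℤ) ∣ j := by
    rw [hc] at h2
    exact (mul_dvd_mul_iff_right hc0).mp h2
  obtain ⟨j', hj'⟩ := h3
  refine ⟨Int.gcdA i (orderOf w) * j', ?_⟩
  simp only
  rw [← zpow_mul, zpow_eq_zpow_iff_modEq, Int.modEq_iff_dvd]
  have hb := Int.gcd_eq_gcd_ab i (orderOf w)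
  exact ⟨Int.gcdB i (orderOf w) * j', by rw [hj']; linear_combination j' * hb⟩

theorem exists_orderOf_eq_prime_notMem_zpowers {G : Type*} [Group G] [Finite G]
    (hG : NoCyclicOrQuaternionSylow G) {p : ℕ} (hp : p.Prime) (hpG : p ∣ Nat.card G) (x : G) :
    ∃ z : G, orderOf z = p ∧ z ∉ Subgroup.zpowers x := by
  obtain ⟨P⟩ : Nonempty (Sylow p G) := inferInstance
  by_contra! hcon
  have hcq := hG p hp hpG P
  refine (isCyclic_or_isGeneralizedQuaternion hp P.isPGroup' ?_).elim hcq.1 hcq.2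
  intro y z hy hz
  have h1 := hcon y (by rwa [Subgroup.orderOf_coe])
  have h2 := hcon z (by rwa [Subgroup.orderOf_coe])
  obtain ⟨k, hk⟩ := mem_zpowers_of_orderOf_dvd (isOfFinOrder_of_finite x) h1 h2
    (by rw [Subgroup.orderOf_coe, Subgroup.orderOf_coe, hy, hz])
  exact ⟨k, Subtype.ext (by simpa using hk)⟩

/-- Certifies that `x` and `t` share no cyclic subgroup: `z` would lie in it, and its order would
place it in `⟨x⟩`. -/
theorem notMem_zpowers_of_dvd_orderOf {G : Type*} [Group G] [Finite G] {x z t w : G}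
    (hzx : z ∉ Subgroup.zpowers x) (hdvd : orderOf z ∣ orderOf x) (hzt : z ∈ Subgroup.zpowers t)
    (hx : x ∈ Subgroup.zpowers w) : t ∉ Subgroup.zpowers w := fun ht =>
  hzx (mem_zpowers_of_orderOf_dvd (isOfFinOrder_of_finite w) hx
    (Subgroup.zpowers_le.mpr ht hzt) hdvd)

/-- Off the identity, the complement of the enhanced power graph has diameter at most two. -/
theorem exists_not_joint_cyclic {G : Type*} [Group G] [Finite G] [Group.IsNilpotent G]
    (hG : NoCyclicOrQuaternionSylow G) {x y : G} (hx : x ≠ 1) (hy : y ≠ 1) :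
    (∀ w, x ∈ Subgroup.zpowers w → y ∉ Subgroup.zpowers w) ∨
      ∃ z, (∀ w, x ∈ Subgroup.zpowers w → z ∉ Subgroup.zpowers w) ∧
        ∀ w, y ∈ Subgroup.zpowers w → z ∉ Subgroup.zpowers w := by
  obtain ⟨p, hp, hpx⟩ := Nat.exists_prime_and_dvd (mt orderOf_eq_one_iff.mp hx)
  obtain ⟨q, hq, hqy⟩ := Nat.exists_prime_and_dvd (mt orderOf_eq_one_iff.mp hy)
  obtain ⟨z, hz, hzx⟩ := exists_orderOf_eq_prime_notMem_zpowers hG hp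
    (hpx.trans (orderOf_dvd_natCard x)) x
  by_cases hpq : p = q
  · subst hpq
    by_cases hxy : ∀ w, x ∈ Subgroup.zpowers w → y ∉ Subgroup.zpowers w
    · exact Or.inl hxy
    push Not at hxy
    obtain ⟨w, hxw, hyw⟩ := hxy
    have hxz : ∀ w, x ∈ Subgroup.zpowers w → z ∉ Subgroup.zpowers w := fun w hw =>
      notMem_zpowers_of_dvd_orderOf hzx (hz ▸ hpx) (Subgroup.mem_zpowers z) hw
    have hzy : z ∉ Subgroup.zpowers y := fun h => hxz w hxw (Subgroup.zpowers_le.mpr hyw h)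
    exact Or.inr ⟨z, hxz, fun w hw =>
      notMem_zpowers_of_dvd_orderOf hzy (hz ▸ hqy) (Subgroup.mem_zpowers z) hw⟩
  · obtain ⟨t, ht, hty⟩ := exists_orderOf_eq_prime_notMem_zpowers hG hq
      (hqy.trans (orderOf_dvd_natCard y)) y
    have hcop : p.Coprime q := (Nat.coprime_primes hp hq).mpr hpq
    have hcomm : Commute z t := commute_of_coprime_orderOf (by rwa [hz, ht])
    have hzt : z ∈ Subgroup.zpowers (z * t) := by
      have h1 : z ∈ Subgroup.zpowers (z ^ q) := mem_zpowers_pow_iff.mpr (by rw [hz]; exact hcop.symm)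
      have h2 : z ^ q = (z * t) ^ q := by
        rw [hcomm.mul_pow, ← ht, pow_orderOf_eq_one, mul_one]
      exact Subgroup.zpowers_le.mpr (Subgroup.npow_mem_zpowers _ q) (h2 ▸ h1)
    have htz : t ∈ Subgroup.zpowers (z * t) := by
      have h1 : t ∈ Subgroup.zpowers (t ^ p) := mem_zpowers_pow_iff.mpr (by rw [ht]; exact hcop)
      have h2 : t ^ p = (z * t) ^ p := by
        rw [hcomm.mul_pow, ← hz, pow_orderOf_eq_one, one_mul]
      exact Subgroup.zpowers_le.mpr (Subgroup.npow_mem_zpowers _ p) (h2 ▸ h1)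
    -- As `z` and `t` commute and have coprime orders, `⟨z * t⟩` contains both: `z` separates it
    -- from `x`, `t` from `y`.
    exact Or.inr ⟨z * t, fun w hw => notMem_zpowers_of_dvd_orderOf hzx (hz ▸ hpx) hzt hw,
      fun w hw => notMem_zpowers_of_dvd_orderOf hty (ht ▸ hqy) htz hw⟩

/-- In the product of a group `H` with a cyclic group of coprime order, the elements `(1, c)` are
dominating in the enhanced power graph. -/
theorem exists_joint_cyclic_of_coprime {H C : Type*} [Group H] [Group C] [IsCyclic C]
    (hHC : (Nat.card H).Coprime (Nat.card C)) (b : H) (c d : C) :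
    ∃ w : H × C, ((1, c) : H × C) ∈ Subgroup.zpowers w ∧ (b, d) ∈ Subgroup.zpowers w := by
  obtain ⟨ζ, hζ⟩ := IsCyclic.exists_generator (α := C)
  have hcop : IsCoprime (Nat.card H : ℤ) (Nat.card C : ℤ) := Nat.isCoprime_iff_coprime.mpr hHC
  obtain ⟨r, s, hrs⟩ := hcop
  have hH : b ^ (Nat.card H : ℤ) = 1 := by simp
  have hC : ζ ^ (Nat.card C : ℤ) = 1 := by simp
  have key : ∀ (m : ℤ) (e : C), (b ^ m, e) ∈ Subgroup.zpowers ((b, ζ) : H × C) := by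
    intro m e
    obtain ⟨l, rfl⟩ := hζ e
    -- Chinese remainder exponent: `m` modulo `|H|`, `l` modulo `|C|`.
    refine ⟨l * (r * Nat.card H) + m * (s * Nat.card C), Prod.ext ?_ ?_⟩
    · have : l * (r * Nat.card H) + m * (s * Nat.card C) = m + Nat.card H * (r * (l - m)) := by
        linear_combination m * hrs
      simp only [Prod.pow_fst, this]
      rw [zpow_add, zpow_mul, hH, one_zpow, mul_one]
    · have : l * (r * Nat.card H) + m * (s * Nat.card C) = l + Nat.card C * (s * (m - l)) := by
        linear_combination l * hrs
      simp only [Prod.pow_snd, this]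
      rw [zpow_add, zpow_mul, hC, one_zpow, mul_one]
  exact ⟨(b, ζ), by simpa using key 0 c, by simpa using key 1 d⟩

/-- For `q` dividing `|K|`, a Sylow `q`-subgroup of `K` already has full `q`-power order in `G`. -/
theorem NoQuaternionSylow.of_coprime_index {G : Type*} [Group G] [Finite G]
    (hG : NoQuaternionSylow G) (K : Subgroup G) (hK : (Nat.card K).Coprime K.index) :
    NoQuaternionSylow K := by
  rintro q hq hqK Q ⟨k, hk, ⟨f⟩⟩
  have : Fact q.Prime := ⟨hq⟩
  have hcard : Nat.card (Q.map K.subtype) = q ^ (Nat.card G).factorization q := by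
    rw [Subgroup.card_map_of_injective K.subtype_injective, Q.card_eq_multiplicity,
      ← K.card_mul_index, Nat.factorization_mul Nat.card_pos.ne' K.index_ne_zero_of_finite,
      Finsupp.add_apply, Nat.factorization_eq_zero_of_not_dvd (n := K.index), add_zero]
    exact fun h => Nat.not_coprime_of_dvd_of_dvd hq.one_lt hqK h hK
  refine hG q hq (hqK.trans K.card_subgroup_dvd_card) (Sylow.ofCard _ hcard) ⟨k, hk, ⟨?_⟩⟩
  exact (Q.equivMapOfInjective K.subtype K.subtype_injective).symm.trans f

/-- A cyclic Sylow subgroup `P` has a complement `K` by Schur–Zassenhaus, which commutes with `P` by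
nilpotency. Induction applies to `K`, and the cyclic factors merge because their orders are coprime.
-/
theorem noCyclicOrQuaternionSylow_or_exists_mulEquiv (N : ℕ) (G : Type u) [Group G] [Finite G]
    [Group.IsNilpotent G] (hN : Nat.card G = N) (hG : NoQuaternionSylow G) :
    NoCyclicOrQuaternionSylow G ∨
      ∃ (G₁ : Type u) (_ : Group G₁) (n : ℕ), Finite G₁ ∧ Group.IsNilpotent G₁ ∧
        NoCyclicOrQuaternionSylow G₁ ∧ 2 ≤ n ∧ Nat.gcd (Nat.card G₁) n = 1 ∧
        Nonempty (G ≃* G₁ × Multiplicative (ZMod n)) := by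
  induction N using Nat.strong_induction_on generalizing G with
  | _ N ih =>
  refine or_iff_not_imp_left.mpr fun hcq => ?_
  obtain ⟨p, hp, hpG, P, hP⟩ : ∃ p : ℕ, p.Prime ∧ p ∣ Nat.card G ∧ ∃ P : Sylow p G, IsCyclic P := by
    unfold NoCyclicOrQuaternionSylow at hcq
    push Not at hcq
    obtain ⟨p, hp, hpG, P, hP⟩ := hcq
    refine ⟨p, hp, hpG, P, ?_⟩
    by_contra hc
    exact hG p hp hpG P (hP hc)
  have : Fact p.Prime := ⟨hp⟩
  obtain ⟨K, hK⟩ := Subgroup.exists_left_complement'_of_coprime P.card_coprime_index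
  have hcard : Nat.card K * Nat.card P = Nat.card G := hK.card_mul_card
  have hKidx : K.index = Nat.card P := hK.symm.index_eq_card
  have hcop : (Nat.card K).Coprime (Nat.card P) := by
    rw [← hK.index_eq_card]
    exact P.card_coprime_index.symm
  have hpP : p ∣ Nat.card P := P.dvd_card_of_dvd_card hpG
  have hP2 : 2 ≤ Nat.card P := hp.two_le.trans (Nat.le_of_dvd Nat.card_pos hpP)
  have hlt : Nat.card K < N := by
    have := Nat.card_pos (α := K)
    rw [← hN, ← hcard]
    nlinarith
  have hcomm : ∀ (k : K) (x : P), Commute (K.subtype k) ((P : Subgroup G).subtype x) := fun k x =>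
    commute_of_coprime_orderOf (Nat.Coprime.of_dvd
      (Subgroup.orderOf_coe k ▸ orderOf_dvd_natCard k)
      (Subgroup.orderOf_coe x ▸ orderOf_dvd_natCard x) hcop)
  have e : G ≃* K × P := (MulEquiv.ofBijective
    (K.subtype.noncommCoprod (P : Subgroup G).subtype hcomm) hK).symm
  rcases ih _ hlt K rfl (hG.of_coprime_index K (hKidx ▸ hcop)) with h | h
  · exact ⟨K, inferInstance, Nat.card P, inferInstance, inferInstance, h, hP2, hcop,
      ⟨e.trans ((MulEquiv.refl K).prodCongr (zmodCyclicMulEquiv hP).symm)⟩⟩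
  · obtain ⟨G₁, _, n, hfin, hnil, hG₁, hn, hgcd, ⟨e'⟩⟩ := h
    have : NeZero n := ⟨by lia⟩
    have hcardK : Nat.card K = Nat.card G₁ * n := by
      rw [Nat.card_congr e'.toEquiv, Nat.card_prod, Nat.card_congr Multiplicative.toAdd,
        Nat.card_zmod]
    rw [hcardK, Nat.coprime_mul_iff_left] at hcop
    have hcyc : IsCyclic (Multiplicative (ZMod n) × P) := by
      rw [Group.isCyclic_prod_iff]
      refine ⟨inferInstance, hP, ?_⟩
      simpa [Nat.card_congr Multiplicative.toAdd] using hcop.2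
    have hcard' : Nat.card (Multiplicative (ZMod n) × P) = n * Nat.card P := by
      rw [Nat.card_prod, Nat.card_congr Multiplicative.toAdd, Nat.card_zmod]
    refine ⟨G₁, inferInstance, n * Nat.card P, hfin, hnil, hG₁, by nlinarith,
      Nat.Coprime.mul_right hgcd hcop.1, ⟨?_⟩⟩
    rw [← hcard']
    exact (e.trans (e'.prodCongr (MulEquiv.refl P))).trans
      (MulEquiv.prodAssoc.trans ((MulEquiv.refl G₁).prodCongr (zmodCyclicMulEquiv hcyc).symm))

end Groups

theorem laplacianSpectralRadiusMultiplicity_enhancedPowerGraph (G : Type u) [Group G] [Fintype G]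
    [Group.IsNilpotent G] (hcyc : ¬ IsCyclic G) (G₁ : Type v) [Group G₁] (n : ℕ)
    (hG₁ : NoCyclicOrQuaternionSylow G₁) (hn : 1 ≤ n) (hgcd : Nat.gcd (Nat.card G₁) n = 1)
    (e : G ≃* G₁ × Multiplicative (ZMod n)) :
    laplacianSpectralRadiusMultiplicity (enhancedPowerGraph G) = n := by
  have : NeZero n := ⟨by lia⟩
  let π : G →* G₁ := (MonoidHom.fst _ _).comp e.toMonoidHom
  have hπ : Function.Surjective π := Prod.fst_surjective.comp e.surjective
  have : Finite G₁ := Finite.of_surjective π hπ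
  have : Group.IsNilpotent G₁ := Group.nilpotent_of_surjective π hπ
  have hcardZ : Nat.card (Multiplicative (ZMod n)) = n := by
    rw [Nat.card_congr Multiplicative.toAdd, Nat.card_zmod]
  -- Homomorphisms preserve joint cyclicity, so non-adjacency lifts from `G₁`.
  have hnadj : ∀ g h : G, (∀ w, π g ∈ Subgroup.zpowers w → π h ∉ Subgroup.zpowers w) →
      (enhancedPowerGraph G)ᶜ.Adj g h := by
    intro g h hgh
    have hmap : ∀ {a w : G}, a ∈ Subgroup.zpowers w → π a ∈ Subgroup.zpowers (π w) := by
      rintro _ w ⟨k, rfl⟩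
      exact ⟨k, by simp⟩
    rw [SimpleGraph.compl_adj]
    refine ⟨?_, fun ⟨_, w, hg, hh⟩ => hgh (π w) (hmap hg) (hmap hh)⟩
    rintro rfl
    exact hgh _ (Subgroup.mem_zpowers _) (Subgroup.mem_zpowers _)
  have hD : (π.ker : Set G).ncard = n := by
    have h1 := π.ker.card_mul_index
    rw [Subgroup.index_ker, MonoidHom.range_eq_top.mpr hπ, Subgroup.card_top,
      Nat.card_congr e.toEquiv, Nat.card_prod, hcardZ, mul_comm (Nat.card G₁)] at h1
    rw [← Nat.card_coe_set_eq]
    exact Nat.eq_of_mul_eq_mul_right Nat.card_pos h1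
  rw [laplacianSpectralRadiusMultiplicity_eq_ncard _ (π.ker : Set G) ?_ ⟨1, one_mem _⟩ ?_ ?_, hD]
  · intro d hd v hv
    refine ⟨hv.symm, ?_⟩
    obtain ⟨w, h1, h2⟩ := exists_joint_cyclic_of_coprime (by rw [hcardZ]; exact hgcd)
      (e v).1 (e d).2 (e v).2
    have hback : ∀ {a : G}, e a ∈ Subgroup.zpowers w → a ∈ Subgroup.zpowers (e.symm w) := by
      rintro a ⟨k, hk⟩
      exact ⟨k, by
        simp only
        rw [← map_zpow, show w ^ k = e a from hk, e.symm_apply_apply]⟩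
    have hd1 : (e d).1 = 1 := hd
    refine ⟨e.symm w, hback ?_, hback h2⟩
    rwa [← hd1] at h1
  -- If the kernel of `π` were everything, `G` would embed in `ℤₙ` and be cyclic.
  · by_contra hempty
    rw [Set.not_nonempty_iff_eq_empty, Set.compl_empty_iff] at hempty
    refine hcyc (isCyclic_of_injective ((MonoidHom.snd _ _).comp e.toMonoidHom) ?_)
    intro a b hab
    have ha : (e a).1 = 1 := by
      have : a ∈ (π.ker : Set G) := hempty ▸ Set.mem_univ a
      exact this
    have hb : (e b).1 = 1 := by
      have : b ∈ (π.ker : Set G) := hempty ▸ Set.mem_univ b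
      exact this
    exact e.injective (Prod.ext (ha.trans hb.symm) hab)
  · intro g hg h hh
    rcases exists_not_joint_cyclic hG₁ (x := π g) (y := π h) hg hh with hgh | ⟨z, h1, h2⟩
    · exact (hnadj g h hgh).reachable
    · obtain ⟨z, rfl⟩ := hπ z
      exact (hnadj g z h1).reachable.trans (hnadj h z h2).reachable.symm

theorem mainTheorem8 (G : Type u) [Group G] [Fintype G] [Group.IsNilpotent G]
    (hG : NoQuaternionSylow G) :
    (NoCyclicOrQuaternionSylow G ∨
      ∃ (G₁ : Type u) (_ : Group G₁) (n : ℕ), Finite G₁ ∧ Group.IsNilpotent G₁ ∧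
        NoCyclicOrQuaternionSylow G₁ ∧ 2 ≤ n ∧ Nat.gcd (Nat.card G₁) n = 1 ∧
        Nonempty (G ≃* G₁ × Multiplicative (ZMod n))) ∧
    (NoCyclicOrQuaternionSylow G →
      laplacianSpectralRadiusMultiplicity (enhancedPowerGraph G) = 1) ∧
    (¬ IsCyclic G →
      ∀ (G₁ : Type v) [Group G₁] (n : ℕ), NoCyclicOrQuaternionSylow G₁ → 1 ≤ n →
        Nat.gcd (Nat.card G₁) n = 1 → Nonempty (G ≃* G₁ × Multiplicative (ZMod n)) →
        laplacianSpectralRadiusMultiplicity (enhancedPowerGraph G) = n) := by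
  refine ⟨noCyclicOrQuaternionSylow_or_exists_mulEquiv _ G rfl hG, fun h => ?_,
    fun hcyc G₁ _ n hG₁ hn hgcd ⟨e⟩ =>
      laplacianSpectralRadiusMultiplicity_enhancedPowerGraph G hcyc G₁ n hG₁ hn hgcd e⟩
  by_cases hcyc : IsCyclic G
  -- Sylow subgroups of a cyclic group are cyclic, so no prime divides `|G|`.
  · have : Subsingleton G := by
      by_contra hns
      rw [not_subsingleton_iff_nontrivial] at hns
      obtain ⟨p, hp, hpG⟩ := Nat.exists_prime_and_dvd (Finite.one_lt_card (α := G)).ne'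
      obtain ⟨P⟩ : Nonempty (Sylow p G) := inferInstance
      exact (h p hp hpG P).1 inferInstance
    exact laplacianSpectralRadiusMultiplicity_of_subsingleton _
  · exact laplacianSpectralRadiusMultiplicity_enhancedPowerGraph G hcyc G 1 h le_rfl
      (Nat.gcd_one_right _) (MulEquiv.prodUnique (M := G) (N := Multiplicative (ZMod 1))).symm
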